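/- Let $X$ be a normal Hausdorff topological space. Let $\mathcal E$ be a coarse structure on $X$, i.e. a family of subsets of $X\times X$ (entourages) that contains the diagonal and is closed under subsets, inverses, compositions and finite unions. Assume that $\mathcal E$ is proper: each entourage is contained in an open entourage, and each bounded set (a set $B$ with $B\times B\in\mathcal E$) has compact closure. For $A,B\subseteq X$ write $A\,\lambda\,B$ if $A\subseteq E(B)$ and $B\subseteq E(A)$ for some $E\in\mathcal E$, where $E(A)=\{y\mid (x,y)\in E\text{ for some }x\in A\}$; this is the asymptotic resemblance associated to $\mathcal E$. A set $A$ is called $\lambda$-bounded if $A=\emptyset$ or $A\,\lambda\,\{x\}$ for some $x\in X$. Two sets $A_1,A_2\subseteq X$ are called asymptotically disjoint if there are no $\lambda$-unbounded $L_1\subseteq A_1$ and $L_2\subseteq A_2$ with $L_1\,\lambda\,L_2$. Assume that $\lambda$ is asymptotically connected ($\{x\}\,\lambda\,\{y\}$ for all $x,y\in X$) and asymptotically normal: whenever $A_1,A_2$ are asymptotically disjoint there are $X_1,X_2\subseteq X$ such that $X=X_1\cup X_2$ and $A_i$, $X_i$ are asymptotically disjoint for $i=1,2$. Let $C_h(X)$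 be the algebra of Higson functions, i.e. of bounded continuous $f:X\to\mathbb C$ such that for all $E\in\mathcal E$ and $\varepsilon>0$ there is a compact $K\subseteq X$ with $|f(x)-f(y)|<\varepsilon$ for all $(x,y)\in E\setminus(K\times K)$. Let $hX$ be the Higson compactification, i.e. the Gelfand spectrum of $C_h(X)$, with the canonical map $e:X\to hX$ that sends $x$ to the evaluation at $x$. Let $\gamma X$ be the Wallman compactification of $X$: its points are the closed ultrafilters on $X$ (maximal proper filters of closed sets), and a basis of its topology is given by the sets $U^*=\{\mathcal F\mid \mathcal F\text{ contains a subset of }U\}$ for $U\subseteq X$ open. For $x\in X$ let $\sigma_x\in\gamma X$ be the family of all closed sets containing $x$. For $\mathcal F_1,\mathcal F_2\in\gamma X$ write $\mathcal F_1\approx\mathcal F_2$ if for all $A\in\mathcal F_1$ and $B\in\mathcal F_2$ there are nonempty sets $L_1\subseteq A$ and $L_2\subseteq B$ such that either $L_1=L_2$, or $L_1$ and $L_2$ are both $\lambda$-unbounded and $L_1\,\lambda\,L_2$. Then $\approx$ is an equivalence relation on $\gamma X$, and the Higson compactification $hX$ is homeomorphic to the asymptotic compactification $\gamma X/{\approx}$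 (with the quotient topology) by a homeomorphism $\Phi$ that is the identity on $X$, i.e. $\Phi(e(x))=[\sigma_x]$ for all $x\in X$. In particular $\Phi$ maps the Higson corona $hX\setminus e(X)$ onto the asymptotic corona $(\gamma X/{\approx})\setminus\{[\sigma_x]\mid x\in X\}$. -/

import Mathlib

open Set Topology BoundedContinuousFunction

/-! ### Asymptotic resemblance relations -/

/-- An asymptotic resemblance (AS.R.) on a set `X`. -/
structure AsymptoticResemblance (X : Type*) where
  /-- `alike A B`: the sets `A` and `B` are asymptotically alike. -/
  alike : Set X → Set X → Prop
  equivalence : Equivalence alike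
  union : ∀ A₁ B₁ A₂ B₂ : Set X, alike A₁ B₁ → alike A₂ B₂ → alike (A₁ ∪ A₂) (B₁ ∪ B₂)
  split : ∀ A B₁ B₂ : Set X, alike (B₁ ∪ B₂) A → B₁.Nonempty → B₂.Nonempty →
    ∃ A₁ A₂ : Set X, A₁.Nonempty ∧ A₂.Nonempty ∧ A = A₁ ∪ A₂ ∧ alike B₁ A₁ ∧ alike B₂ A₂

namespace AsymptoticResemblance

variable {X : Type*} (l : AsymptoticResemblance X)

/-- A set is bounded if it is empty or asymptotically alike to a point. -/
def Bounded (A : Set X) : Prop := A = ∅ ∨ ∃ x : X, l.alike A {x}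

/-- All points are asymptotically alike. -/
def AsymptoticallyConnected : Prop := ∀ x y : X, l.alike {x} {y}

/-- No unbounded subset of `A₁` is asymptotically alike to an unbounded subset of `A₂`. -/
def AsymptoticallyDisjoint (A₁ A₂ : Set X) : Prop :=
  ∀ L₁ L₂ : Set X, L₁ ⊆ A₁ → L₂ ⊆ A₂ → ¬ l.Bounded L₁ → ¬ l.Bounded L₂ → ¬ l.alike L₁ L₂

def AsymptoticallyNormal : Prop :=
  ∀ A₁ A₂ : Set X, l.AsymptoticallyDisjoint A₁ A₂ →
    ∃ X₁ X₂ : Set X, X₁ ∪ X₂ = Set.univ ∧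
      l.AsymptoticallyDisjoint A₁ X₁ ∧ l.AsymptoticallyDisjoint A₂ X₂

/-- The relation `A ∼ B` on nonempty sets: `A = B`, or `A` and `B` are unbounded and
asymptotically alike. -/
def Sim (A B : Set X) : Prop :=
  A.Nonempty ∧ B.Nonempty ∧ (A = B ∨ (¬ l.Bounded A ∧ ¬ l.Bounded B ∧ l.alike A B))

end AsymptoticResemblance

/-! ### Coarse structures -/

/-- A (unitary) coarse structure on a set `X`. Recall that `E.inv = {(x, y) | (y, x) ∈ E}` and that
`F.comp E = {(x, y) | ∃ z, (x, z) ∈ F ∧ (z, y) ∈ E}`. -/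
structure CoarseStructure (X : Type*) where
  entourages : Set (SetRel X X)
  diagonal_mem : {p : X × X | p.1 = p.2} ∈ entourages
  subset_mem : ∀ E F : SetRel X X, E ∈ entourages → F ⊆ E → F ∈ entourages
  inv_mem : ∀ E : SetRel X X, E ∈ entourages → E.inv ∈ entourages
  comp_mem : ∀ E F : SetRel X X, E ∈ entourages → F ∈ entourages → F.comp E ∈ entourages
  union_mem : ∀ E F : SetRel X X, E ∈ entourages → F ∈ entourages → E ∪ F ∈ entourages

namespace CoarseStructure

variable {X : Type*} (𝓔 : CoarseStructure X)

/-- The asymptotic resemblance associated to a coarse structure: `A` and `B` are asymptotically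
alike if `A ⊆ E(B)` and `B ⊆ E(A)` for some entourage `E`, where
`E(A) = E.image A = {y | ∃ x ∈ A, (x, y) ∈ E}`. -/
def toAsymptoticResemblance : AsymptoticResemblance X where
  alike A B := ∃ E ∈ 𝓔.entourages, A ⊆ E.image B ∧ B ⊆ E.image A
  equivalence := by
    refine ⟨fun A => ⟨_, 𝓔.diagonal_mem, fun x hx => ⟨x, hx, rfl⟩, fun x hx => ⟨x, hx, rfl⟩⟩,
      fun ⟨E, hE, h₁, h₂⟩ => ⟨E, hE, h₂, h₁⟩, ?_⟩
    rintro A B C ⟨E, hE, hAB, hBA⟩ ⟨F, hF, hBC, hCB⟩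
    refine ⟨_, 𝓔.union_mem _ _ (𝓔.comp_mem E F hE hF) (𝓔.comp_mem F E hF hE), ?_, ?_⟩
    · intro a ha
      obtain ⟨b, hb, hba⟩ := hAB ha
      obtain ⟨c, hc, hcb⟩ := hBC hb
      exact ⟨c, hc, Or.inl ⟨b, hcb, hba⟩⟩
    · intro c hc
      obtain ⟨b, hb, hbc⟩ := hCB hc
      obtain ⟨a, ha, hab⟩ := hBA hb
      exact ⟨a, ha, Or.inr ⟨b, hab, hbc⟩⟩
  union := by
    rintro A₁ B₁ A₂ B₂ ⟨E, hE, h₁, h₂⟩ ⟨F, hF, h₃, h₄⟩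
    refine ⟨_, 𝓔.union_mem E F hE hF, ?_, ?_⟩
    · rintro a (ha | ha)
      · obtain ⟨b, hb, h⟩ := h₁ ha
        exact ⟨b, Or.inl hb, Or.inl h⟩
      · obtain ⟨b, hb, h⟩ := h₃ ha
        exact ⟨b, Or.inr hb, Or.inr h⟩
    · rintro b (hb | hb)
      · obtain ⟨a, ha, h⟩ := h₂ hb
        exact ⟨a, Or.inl ha, Or.inl h⟩
      · obtain ⟨a, ha, h⟩ := h₄ hb
        exact ⟨a, Or.inr ha, Or.inr h⟩
  split := by
    rintro A B₁ B₂ ⟨E, hE, h₁, h₂⟩ hB₁ hB₂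
    have key : ∀ B : Set X, B ⊆ B₁ ∪ B₂ → B.Nonempty →
        (A ∩ (E ∪ E.inv).image B).Nonempty ∧
        ∃ F ∈ 𝓔.entourages, B ⊆ F.image (A ∩ (E ∪ E.inv).image B) ∧
          A ∩ (E ∪ E.inv).image B ⊆ F.image B := by
      intro B hB hne
      have hsub : B ⊆ (E ∪ E.inv).image (A ∩ (E ∪ E.inv).image B) := by
        intro b hb
        obtain ⟨a, ha, hab⟩ := h₁ (hB hb)
        exact ⟨a, ⟨ha, b, hb, Or.inr hab⟩, Or.inl hab⟩
      refine ⟨?_, E ∪ E.inv, 𝓔.union_mem _ _ hE (𝓔.inv_mem _ hE), hsub, fun a ha => ha.2⟩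
      obtain ⟨b, hb⟩ := hne
      obtain ⟨a, ha, -⟩ := hsub hb
      exact ⟨a, ha⟩
    obtain ⟨n₁, k₁⟩ := key B₁ subset_union_left hB₁
    obtain ⟨n₂, k₂⟩ := key B₂ subset_union_right hB₂
    refine ⟨_, _, n₁, n₂, ?_, k₁, k₂⟩
    ext a
    constructor
    · intro ha
      obtain ⟨b, hb | hb, hba⟩ := h₂ ha
      · exact Or.inl ⟨ha, b, hb, Or.inl hba⟩
      · exact Or.inr ⟨ha, b, hb, Or.inl hba⟩
    · rintro (ha | ha) <;> exact ha.1

/-- A set `B` is bounded in a coarse space if `B × B` is an entourage. -/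
def Bounded (B : Set X) : Prop := B ×ˢ B ∈ 𝓔.entourages

/-- A coarse structure on a topological space is proper if each entourage is contained in an open
entourage and each bounded set has compact closure. -/
structure IsProper [TopologicalSpace X] : Prop where
  exists_isOpen : ∀ E ∈ 𝓔.entourages, ∃ U ∈ 𝓔.entourages, IsOpen U ∧ E ⊆ U
  isCompact_closure : ∀ B : Set X, 𝓔.Bounded B → IsCompact (closure B)

/-! ### The Higson compactification -/

/-- The condition that makes a bounded continuous function `f : X → ℂ` a Higson function. -/
def IsHigson [TopologicalSpace X] (f : X →ᵇ ℂ) : Prop :=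
  ∀ E ∈ 𝓔.entourages, ∀ ε : ℝ, 0 < ε → ∃ K : Set X, IsCompact K ∧
    ∀ x y : X, (x, y) ∈ E \ K ×ˢ K → ‖f x - f y‖ < ε

/-- The algebra `C_h(X)` of Higson functions, with the supremum norm. -/
noncomputable def higsonAlgebra [TopologicalSpace X] : StarSubalgebra ℂ (X →ᵇ ℂ) where
  carrier := {f | 𝓔.IsHigson f}
  mul_mem' := by
    intro f g hf hg E hE ε hε
    have hM : 0 < ‖f‖ + ‖g‖ + 1 := by positivity
    obtain ⟨K, hK, h₁⟩ := hf E hE (ε / (‖f‖ + ‖g‖ + 1)) (by positivity)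
    obtain ⟨L, hL, h₂⟩ := hg E hE (ε / (‖f‖ + ‖g‖ + 1)) (by positivity)
    refine ⟨K ∪ L, hK.union hL, ?_⟩
    rintro x y ⟨hxy, hn⟩
    have a₁ := h₁ x y ⟨hxy, fun h => hn ⟨Or.inl h.1, Or.inl h.2⟩⟩
    have a₂ := h₂ x y ⟨hxy, fun h => hn ⟨Or.inr h.1, Or.inr h.2⟩⟩
    have e : (f * g) x - (f * g) y = f x * (g x - g y) + (f x - f y) * g y := by
      simp only [BoundedContinuousFunction.mul_apply]
      ring
    rw [e]
    refine (norm_add_le _ _).trans_lt ?_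
    rw [norm_mul, norm_mul]
    have b₁ : ‖f x‖ * ‖g x - g y‖ ≤ ‖f‖ * (ε / (‖f‖ + ‖g‖ + 1)) :=
      mul_le_mul (f.norm_coe_le_norm x) a₂.le (norm_nonneg _) (norm_nonneg _)
    have b₂ : ‖f x - f y‖ * ‖g y‖ ≤ (ε / (‖f‖ + ‖g‖ + 1)) * ‖g‖ :=
      mul_le_mul a₁.le (g.norm_coe_le_norm y) (norm_nonneg _) (by positivity)
    have b₃ : 0 < ε / (‖f‖ + ‖g‖ + 1) := by positivity
    have b₄ : ε / (‖f‖ + ‖g‖ + 1) * (‖f‖ + ‖g‖ + 1) = ε := by field_simp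
    linarith
  one_mem' := by
    intro E hE ε hε
    exact ⟨∅, isCompact_empty, fun x y _ => by simpa using hε⟩
  add_mem' := by
    intro f g hf hg E hE ε hε
    obtain ⟨K, hK, h₁⟩ := hf E hE (ε / 2) (by positivity)
    obtain ⟨L, hL, h₂⟩ := hg E hE (ε / 2) (by positivity)
    refine ⟨K ∪ L, hK.union hL, ?_⟩
    rintro x y ⟨hxy, hn⟩
    have a₁ := h₁ x y ⟨hxy, fun h => hn ⟨Or.inl h.1, Or.inl h.2⟩⟩
    have a₂ := h₂ x y ⟨hxy, fun h => hn ⟨Or.inr h.1, Or.inr h.2⟩⟩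
    have e : (f + g) x - (f + g) y = (f x - f y) + (g x - g y) := by
      simp only [BoundedContinuousFunction.add_apply]
      ring
    rw [e]
    refine (norm_add_le _ _).trans_lt ?_
    linarith
  zero_mem' := by
    intro E hE ε hε
    exact ⟨∅, isCompact_empty, fun x y _ => by simpa using hε⟩
  algebraMap_mem' := by
    intro r E hE ε hε
    exact ⟨∅, isCompact_empty, fun x y _ => by
      simpa [BoundedContinuousFunction.algebraMap_apply] using hε⟩
  star_mem' := by
    intro f hf E hE ε hε
    obtain ⟨K, hK, h⟩ := hf E hE ε hε
    refine ⟨K, hK, fun x y hxy => ?_⟩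
    have := h x y hxy
    rw [BoundedContinuousFunction.star_apply, BoundedContinuousFunction.star_apply, ← star_sub,
      norm_star]
    exact this

/-- The Higson compactification `hX`: the Gelfand spectrum of `C_h(X)`, that is, the space of
characters of `C_h(X)` with the weak-* topology. -/
abbrev HigsonCompactification [TopologicalSpace X] : Type _ :=
  WeakDual.characterSpace ℂ 𝓔.higsonAlgebra

/-- The canonical map `X → hX`, which sends `x` to the evaluation at `x`. -/
noncomputable def toHigson [TopologicalSpace X] (x : X) : 𝓔.HigsonCompactification :=
  ⟨StrongDual.toWeakDual
      ((BoundedContinuousFunction.evalCLM ℂ x).comp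
        (Subalgebra.toSubmodule 𝓔.higsonAlgebra.toSubalgebra).subtypeL), by
    refine ⟨fun h => ?_, fun f g => rfl⟩
    have h1 := congrArg (fun φ : WeakDual ℂ 𝓔.higsonAlgebra => φ 1) h
    exact one_ne_zero h1⟩

/-- The Higson corona `hX \ X`. -/
def higsonCorona [TopologicalSpace X] : Set 𝓔.HigsonCompactification :=
  (Set.range 𝓔.toHigson)ᶜ

end CoarseStructure

/-! ### The Wallman compactification -/

/-- A (proper) filter of closed subsets of `X`. -/
structure IsClosedFilter {X : Type*} [TopologicalSpace X] (𝓕 : Set (Set X)) : Prop where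
  isClosed : ∀ A ∈ 𝓕, IsClosed A
  univ_mem : Set.univ ∈ 𝓕
  empty_notMem : ∅ ∉ 𝓕
  inter_mem : ∀ A ∈ 𝓕, ∀ B ∈ 𝓕, A ∩ B ∈ 𝓕
  superset_mem : ∀ A ∈ 𝓕, ∀ B : Set X, IsClosed B → A ⊆ B → B ∈ 𝓕

/-- The set `γX` of closed ultrafilters on `X`, i.e. of maximal filters of closed sets. -/
def Wallman (X : Type*) [TopologicalSpace X] : Type _ :=
  {𝓕 : Set (Set X) // Maximal IsClosedFilter 𝓕}

namespace Wallman

variable {X : Type*} [TopologicalSpace X]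

/-- The set `U*` of closed ultrafilters that contain a subset of `U`. -/
def basicOpen (U : Set X) : Set (Wallman X) := {𝓕 | ∃ A ∈ 𝓕.1, A ⊆ U}

/-- The topology of `γX` has the sets `U*`, `U` open in `X`, as a basis. -/
instance : TopologicalSpace (Wallman X) :=
  TopologicalSpace.generateFrom {W | ∃ U : Set X, IsOpen U ∧ W = basicOpen U}

/-- The map `σ : X → γX`; `σ x` is the family of all closed sets that contain `x`. -/
def σ [T1Space X] (x : X) : Wallman X :=
  ⟨{A | IsClosed A ∧ x ∈ A}, by
    refine ⟨⟨fun A hA => hA.1, ⟨isClosed_univ, trivial⟩, fun h => h.2,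
      fun A hA B hB => ⟨hA.1.inter hB.1, hA.2, hB.2⟩, fun A hA B hB hAB => ⟨hB, hAB hA.2⟩⟩, ?_⟩
    intro 𝓖 h𝓖 hle A hA
    refine ⟨h𝓖.isClosed A hA, ?_⟩
    by_contra hx
    have hxm : ({x} : Set X) ∈ 𝓖 := hle ⟨isClosed_singleton, rfl⟩
    have := h𝓖.inter_mem _ hxm _ hA
    rw [Set.singleton_inter_eq_empty.mpr hx] at this
    exact h𝓖.empty_notMem this⟩

end Wallman

/-! ### The asymptotic compactification -/

namespace AsymptoticResemblance

variable {X : Type*} [TopologicalSpace X] (l : AsymptoticResemblance X)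

/-- The relation `𝓕₁ ≈ 𝓕₂` on `γX`. -/
def Approx (𝓕₁ 𝓕₂ : Wallman X) : Prop :=
  ∀ A ∈ 𝓕₁.1, ∀ B ∈ 𝓕₂.1, ∃ L₁ L₂ : Set X, L₁ ⊆ A ∧ L₂ ⊆ B ∧ l.Sim L₁ L₂

/-- The quotient space `γX/≈` with the quotient topology. -/
abbrev AsymptoticCompactification : Type _ := Quot l.Approx

/-- The canonical map `φ : X → γX/≈`, `φ x = [σ x]`. -/
def toAsymptotic [T1Space X] (x : X) : l.AsymptoticCompactification :=
  Quot.mk _ (Wallman.σ x)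

/-- The asymptotic corona `(γX/≈) \ φ(X)`. -/
def asymptoticCorona [T1Space X] : Set l.AsymptoticCompactification :=
  (Set.range l.toAsymptotic)ᶜ

end AsymptoticResemblance

/-! ### Bounded sets and asymptotically disjoint sets of a coarse structure -/

namespace CoarseStructure

variable {X : Type*} {𝓔 : CoarseStructure X}

/-! A bounded continuous function has a limit along each closed ultrafilter, and taking limits of
Higson functions gives a continuous map `wallmanToHigson` from `γX` to `hX`. It is onto, and its
fibres are exactly the classes of `≈`; so `≈` is an equivalence relation, and the induced continuous
bijection from the compact space `γX/≈` to the Hausdorff space `hX` is a homeomorphism. It respects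
the points of `X` because the limit along `σ x` is evaluation at `x`.

Surjectivity (`surjective_wallmanToHigson`): the sets where elements of the kernel of a character
are small generate a closed filter, and any closed ultrafilter containing it induces that character.

Fibres (`IsProper.wallmanToHigson_eq_iff`): a Higson function is almost equal at suitable points of
two alike unbounded sets, so `≈` forces equal limits. If `≈` fails, some members of the two
ultrafilters are disjoint and asymptotically disjoint. Urysohn's construction, with asymptotic
normality imposed at each interpolation, separates them by a Higson function. -/

theorem bounded_empty : 𝓔.Bounded ∅ :=
  𝓔.subset_mem _ _ 𝓔.diagonal_mem (by simp)

theorem Bounded.mono {A B : Set X} (hB : 𝓔.Bounded B) (h : A ⊆ B) : 𝓔.Bounded A :=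
  𝓔.subset_mem _ _ hB (prod_mono h h)

theorem bounded_image_singleton {E : SetRel X X} (hE : E ∈ 𝓔.entourages) (x : X) :
    𝓔.Bounded (E.image {x}) := by
  refine 𝓔.subset_mem _ _ (𝓔.comp_mem E _ hE (𝓔.inv_mem _ hE)) ?_
  rintro ⟨a, b⟩ ⟨⟨_, rfl, ha⟩, ⟨_, rfl, hb⟩⟩
  exact ⟨_, ha, hb⟩

theorem Bounded.image {A : Set X} (hA : 𝓔.Bounded A) {E : SetRel X X} (hE : E ∈ 𝓔.entourages) :
    𝓔.Bounded (E.image A) := by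
  refine 𝓔.subset_mem _ _
    (𝓔.comp_mem E _ hE (𝓔.comp_mem _ _ hA (𝓔.inv_mem _ hE))) ?_
  rintro ⟨a, b⟩ ⟨⟨c, hc, hca⟩, ⟨d, hd, hdb⟩⟩
  exact ⟨d, ⟨c, hca, hc, hd⟩, hdb⟩

theorem bounded_toAsymptoticResemblance_iff {A : Set X} :
    𝓔.toAsymptoticResemblance.Bounded A ↔ 𝓔.Bounded A := by
  constructor
  · rintro (rfl | ⟨x, E, hE, h, -⟩)
    · exact bounded_empty
    · exact (bounded_image_singleton hE x).mono h
  · intro hA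
    rcases A.eq_empty_or_nonempty with rfl | ⟨x, hx⟩
    · exact Or.inl rfl
    · refine Or.inr ⟨x, _, hA, fun a ha => ⟨x, rfl, hx, ha⟩, ?_⟩
      rintro _ rfl
      exact ⟨_, hx, hx, hx⟩

/-- Connectedness is what links the base points of the two sets. -/
theorem Bounded.union (hconn : 𝓔.toAsymptoticResemblance.AsymptoticallyConnected) {A B : Set X}
    (hA : 𝓔.Bounded A) (hB : 𝓔.Bounded B) : 𝓔.Bounded (A ∪ B) := by
  rw [← bounded_toAsymptoticResemblance_iff] at *
  rcases hA with rfl | ⟨x, hx⟩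
  · simpa using hB
  rcases hB with rfl | ⟨y, hy⟩
  · rw [union_empty]
    exact Or.inr ⟨x, hx⟩
  refine Or.inr ⟨x, ?_⟩
  simpa using 𝓔.toAsymptoticResemblance.union _ _ _ _ hx
    (𝓔.toAsymptoticResemblance.equivalence.trans hy (hconn y x))

theorem alike_of_entourage {E : SetRel X X} (hE : E ∈ 𝓔.entourages) {A B : Set X}
    (hA : ∀ a ∈ A, ∃ b ∈ B, (a, b) ∈ E) (hB : ∀ b ∈ B, ∃ a ∈ A, (a, b) ∈ E) :
    𝓔.toAsymptoticResemblance.alike A B := by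
  refine ⟨_, 𝓔.union_mem _ _ hE (𝓔.inv_mem _ hE), fun a ha => ?_, fun b hb => ?_⟩
  · obtain ⟨b, hb, h⟩ := hA a ha
    exact ⟨b, hb, Or.inr h⟩
  · obtain ⟨a, ha, h⟩ := hB b hb
    exact ⟨a, ha, Or.inl h⟩

/-- The points of `A` that `E` joins to `B` are alike to their partners in `B`, and one of these
sets is bounded if the other is. This form, one bounded set per entourage, makes unions and
thickenings easy to handle. -/
theorem asymptoticallyDisjoint_iff {A B : Set X} :
    𝓔.toAsymptoticResemblance.AsymptoticallyDisjoint A B ↔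
      ∀ E ∈ 𝓔.entourages, 𝓔.Bounded {x | x ∈ A ∧ ∃ y ∈ B, (x, y) ∈ E} := by
  simp only [AsymptoticResemblance.AsymptoticallyDisjoint, bounded_toAsymptoticResemblance_iff]
  constructor
  · intro h E hE
    by_contra hn
    refine h _ {y | y ∈ B ∧ ∃ x ∈ A, (x, y) ∈ E} (fun x hx => hx.1) (fun y hy => hy.1) hn
      (fun hb => hn ?_) (alike_of_entourage hE ?_ ?_)
    · refine (hb.image (𝓔.inv_mem _ hE)).mono ?_
      rintro x ⟨hx, y, hy, hxy⟩
      exact ⟨y, ⟨hy, x, hx, hxy⟩, hxy⟩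
    · rintro x ⟨hx, y, hy, hxy⟩
      exact ⟨y, ⟨hy, x, hx, hxy⟩, hxy⟩
    · rintro y ⟨hy, x, hx, hxy⟩
      exact ⟨x, ⟨hx, y, hy, hxy⟩, hxy⟩
  · rintro h L₁ L₂ h₁ h₂ hL₁ - ⟨E, hE, hs, -⟩
    refine hL₁ ((h _ (𝓔.inv_mem _ hE)).mono fun x hx => ⟨h₁ hx, ?_⟩)
    obtain ⟨y, hy, hyx⟩ := hs hx
    exact ⟨y, h₂ hy, hyx⟩

end CoarseStructure

/-! ### Permanence properties of asymptotic disjointness. -/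

namespace AsymptoticResemblance

variable {X : Type*} {l : AsymptoticResemblance X} {A A' B B' : Set X}

theorem AsymptoticallyDisjoint.symm (h : l.AsymptoticallyDisjoint A B) :
    l.AsymptoticallyDisjoint B A :=
  fun L₁ L₂ h₁ h₂ u₁ u₂ ha => h L₂ L₁ h₂ h₁ u₂ u₁ (l.equivalence.symm ha)

theorem AsymptoticallyDisjoint.mono (h : l.AsymptoticallyDisjoint A B) (hA : A' ⊆ A)
    (hB : B' ⊆ B) : l.AsymptoticallyDisjoint A' B' :=
  fun L₁ L₂ h₁ h₂ => h L₁ L₂ (h₁.trans hA) (h₂.trans hB)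

end AsymptoticResemblance

namespace CoarseStructure

variable {X : Type*} {𝓔 : CoarseStructure X} {A B C : Set X}

theorem asymptoticallyDisjoint_union_right
    (hconn : 𝓔.toAsymptoticResemblance.AsymptoticallyConnected)
    (hB : 𝓔.toAsymptoticResemblance.AsymptoticallyDisjoint A B)
    (hC : 𝓔.toAsymptoticResemblance.AsymptoticallyDisjoint A C) :
    𝓔.toAsymptoticResemblance.AsymptoticallyDisjoint A (B ∪ C) := by
  rw [asymptoticallyDisjoint_iff] at *
  refine fun E hE => ((hB E hE).union hconn (hC E hE)).mono ?_
  rintro x ⟨hx, y, hy | hy, hxy⟩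
  · exact Or.inl ⟨hx, y, hy, hxy⟩
  · exact Or.inr ⟨hx, y, hy, hxy⟩

/-- Thickening by `D` is absorbed into the entourage by composition. -/
theorem asymptoticallyDisjoint_image_right
    (h : 𝓔.toAsymptoticResemblance.AsymptoticallyDisjoint A B)
    {D : SetRel X X} (hD : D ∈ 𝓔.entourages) :
    𝓔.toAsymptoticResemblance.AsymptoticallyDisjoint A (D.image B) := by
  rw [asymptoticallyDisjoint_iff] at *
  refine fun E hE => (h _ (𝓔.comp_mem _ _ (𝓔.inv_mem _ hD) hE)).mono ?_
  rintro x ⟨hx, y, ⟨b, hb, hby⟩, hxy⟩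
  exact ⟨hx, b, hb, y, hxy, hby⟩

/-! ### Proper coarse structures and Urysohn functions. -/

variable [TopologicalSpace X]

theorem isOpen_image {D : SetRel X X} (hD : IsOpen D) (A : Set X) : IsOpen (D.image A) := by
  have : D.image A = ⋃ a ∈ A, {y | (a, y) ∈ D} := by
    ext y
    simp
  rw [this]
  exact isOpen_biUnion fun a _ => hD.preimage (by fun_prop)

theorem IsProper.exists_isOpen_diagonal (hproper : 𝓔.IsProper) :
    ∃ D ∈ 𝓔.entourages, IsOpen D ∧ ∀ x, (x, x) ∈ D := by
  obtain ⟨D, hD, ho, hsub⟩ := hproper.exists_isOpen _ 𝓔.diagonal_mem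
  exact ⟨D, hD, ho, fun x => hsub (show (x, x).1 = (x, x).2 from rfl)⟩

/-- `D.image {y}` is an open neighbourhood of `y`, so it meets `D.image A`. Taking the closure thus
costs only one more entourage. -/
theorem closure_image_subset {D : SetRel X X} (hD : IsOpen D) (hd : ∀ x, (x, x) ∈ D)
    (A : Set X) : closure (D.image A) ⊆ D.inv.image (D.image A) := by
  intro y hy
  obtain ⟨z, hz, hzA⟩ := mem_closure_iff.1 hy _ (isOpen_image hD {y}) ⟨y, rfl, hd y⟩
  obtain ⟨_, rfl, h⟩ := hz
  exact ⟨z, hzA, h⟩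

theorem IsProper.bounded_of_isCompact (hproper : 𝓔.IsProper)
    (hconn : 𝓔.toAsymptoticResemblance.AsymptoticallyConnected) {K : Set X} (hK : IsCompact K) :
    𝓔.Bounded K := by
  obtain ⟨D, hD, ho, hd⟩ := hproper.exists_isOpen_diagonal
  refine hK.induction_on bounded_empty (fun s t hst ht => ht.mono hst)
    (fun s t hs ht => hs.union hconn ht) fun x _ => ⟨D.image {x}, ?_, bounded_image_singleton hD x⟩
  exact mem_nhdsWithin_of_mem_nhds ((isOpen_image ho {x}).mem_nhds ⟨x, rfl, hd x⟩)

/-- Both points must lie in `K`, since the Higson condition exempts only pairs in `K ×ˢ K`; hence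
the bounded set of first points is enlarged by its `E`-image. -/
theorem IsProper.exists_isCompact_of_asymptoticallyDisjoint (hproper : 𝓔.IsProper)
    (hconn : 𝓔.toAsymptoticResemblance.AsymptoticallyConnected)
    (h : 𝓔.toAsymptoticResemblance.AsymptoticallyDisjoint A B)
    {E : SetRel X X} (hE : E ∈ 𝓔.entourages) :
    ∃ K, IsCompact K ∧ ∀ x y, (x, y) ∈ E → x ∈ A → y ∈ B → x ∈ K ∧ y ∈ K := by
  have hb := asymptoticallyDisjoint_iff.1 h E hE
  refine ⟨_, hproper.isCompact_closure _ (hb.union hconn (hb.image hE)), fun x y hxy hx hy => ?_⟩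
  have hx' : x ∈ {x | x ∈ A ∧ ∃ y ∈ B, (x, y) ∈ E} := ⟨hx, y, hy, hxy⟩
  exact ⟨subset_closure (Or.inl hx'), subset_closure (Or.inr ⟨x, hx', hxy⟩)⟩

/-- The interpolation step of Urysohn's lemma. Asymptotically `v` should be `X₂`, made open by
thickening. Removing `closure G`, which lies near `uᶜ`, gives `closure v ⊆ u`; adding `W`, which
lies near `c`, gives `c ⊆ v`. Both corrections stay within one entourage of `uᶜ` or `c`, so they
preserve the asymptotic conditions. -/
theorem IsProper.exists_isOpen_between [NormalSpace X] (hproper : 𝓔.IsProper)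
    (hconn : 𝓔.toAsymptoticResemblance.AsymptoticallyConnected)
    (hnormal : 𝓔.toAsymptoticResemblance.AsymptoticallyNormal) {c u : Set X} (hc : IsClosed c)
    (h : 𝓔.toAsymptoticResemblance.AsymptoticallyDisjoint c uᶜ) (hu : IsOpen u) (hcu : c ⊆ u) :
    ∃ v, IsOpen v ∧ c ⊆ v ∧ closure v ⊆ u ∧
      𝓔.toAsymptoticResemblance.AsymptoticallyDisjoint c vᶜ ∧
      𝓔.toAsymptoticResemblance.AsymptoticallyDisjoint (closure v) uᶜ := by
  obtain ⟨D, hD, ho, hd⟩ := hproper.exists_isOpen_diagonal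
  have subset_image (A : Set X) : A ⊆ D.image A := fun x hx => ⟨x, hx, hd x⟩
  have hDi := 𝓔.inv_mem _ hD
  obtain ⟨X₁, X₂, hX, h₁, h₂⟩ := hnormal _ _ h
  obtain ⟨W, hWo, hcW, hW⟩ := normal_exists_closure_subset hc (hu.inter (isOpen_image ho c))
    (subset_inter hcu (subset_image c))
  obtain ⟨G, hGo, huG, hG⟩ := normal_exists_closure_subset hu.isClosed_compl
    (isOpen_image ho uᶜ) (subset_image uᶜ)
  refine ⟨(D.image X₂ ∩ (closure G)ᶜ) ∪ W,
    ((isOpen_image ho X₂).inter isClosed_closure.isOpen_compl).union hWo,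
    hcW.trans subset_union_right, ?_, ?_, ?_⟩
  · rw [closure_union]
    refine union_subset ((closure_minimal (t := Gᶜ) ?_ hGo.isClosed_compl).trans ?_)
      (hW.trans inter_subset_left)
    · exact inter_subset_right.trans (compl_subset_compl.2 subset_closure)
    · exact compl_subset_comm.1 huG
  · refine (asymptoticallyDisjoint_union_right hconn h₁
      (asymptoticallyDisjoint_image_right h hD)).mono Subset.rfl fun x hx => ?_
    by_cases hxG : x ∈ closure G
    · exact Or.inr (hG hxG)
    · have hx₂ : x ∉ X₂ := fun hx₂ => hx (Or.inl ⟨subset_image _ hx₂, hxG⟩)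
      exact Or.inl (((hX ▸ mem_univ x : x ∈ X₁ ∪ X₂)).resolve_right hx₂)
  · refine (asymptoticallyDisjoint_union_right hconn
      (asymptoticallyDisjoint_image_right (asymptoticallyDisjoint_image_right h₂ hD) hDi)
      (asymptoticallyDisjoint_image_right h.symm hD)).symm.mono ?_ Subset.rfl
    rw [closure_union]
    exact union_subset_union
      ((closure_mono inter_subset_left).trans (closure_image_subset ho hd X₂))
      (hW.trans inter_subset_right)

/-- The Urysohn function of asymptotically disjoint sets varies slowly outside a compact set. -/
theorem IsProper.exists_isCompact_dist_lim_le (hproper : 𝓔.IsProper)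
    (hconn : 𝓔.toAsymptoticResemblance.AsymptoticallyConnected)
    {E : SetRel X X} (hE : E ∈ 𝓔.entourages) (n : ℕ)
    (c : Urysohns.CU fun c u : Set X => 𝓔.toAsymptoticResemblance.AsymptoticallyDisjoint c uᶜ) :
    ∃ K, IsCompact K ∧ ∀ x y, (x, y) ∈ E → ¬ (x ∈ K ∧ y ∈ K) →
      dist (c.lim x) (c.lim y) ≤ (3 / 4 : ℝ) ^ n := by
  induction n generalizing c with
  | zero =>
    refine ⟨∅, isCompact_empty, fun x y _ _ => ?_⟩
    rw [pow_zero]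
    exact Real.dist_le_of_mem_Icc_01 (c.lim_mem_Icc _) (c.lim_mem_Icc _)
  | succ n ih =>
    obtain ⟨K₁, hK₁, h₁⟩ := ih c.left
    obtain ⟨K₂, hK₂, h₂⟩ := ih c.left.right
    obtain ⟨K₃, hK₃, h₃⟩ := ih c.right
    -- `closure c.left.left.U` is asymptotically disjoint from the complement of `c.left.U`, so
    -- outside a compact set no `E`-pair jumps across this gap, in either order.
    have hP := c.left.right.P_C_U
    obtain ⟨K₄, hK₄, h₄⟩ := hproper.exists_isCompact_of_asymptoticallyDisjoint hconn hP hE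
    obtain ⟨K₅, hK₅, h₅⟩ := hproper.exists_isCompact_of_asymptoticallyDisjoint hconn hP.symm hE
    refine ⟨K₁ ∪ (K₂ ∪ (K₃ ∪ (K₄ ∪ K₅))),
      hK₁.union (hK₂.union (hK₃.union (hK₄.union hK₅))), fun x y hxy hn => ?_⟩
    simp only [mem_union] at hn
    replace h₁ := h₁ x y hxy (by tauto)
    replace h₂ := h₂ x y hxy (by tauto)
    replace h₃ := h₃ x y hxy (by tauto)
    replace h₄ : x ∈ c.left.right.C → y ∈ c.left.U := fun hx => by
      by_contra hy
      have := h₄ x y hxy hx hy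
      tauto
    replace h₅ : y ∈ c.left.right.C → x ∈ c.left.U := fun hy => by
      by_contra hx
      have := h₅ x y hxy hx hy
      tauto
    -- If both points lie in `c.left.U`, the right half vanishes at both and the bound is halved.
    -- Otherwise both lie outside `c.left.left.U`, that quarter equals 1 at both, and the remaining
    -- weights 1/4 and 1/2 give the factor 3/4.
    by_cases hl : x ∈ c.left.U ∧ y ∈ c.left.U
    · rw [pow_succ', c.lim_eq_midpoint, c.lim_eq_midpoint,
        c.right.lim_of_mem_C _ (c.left_U_subset_right_C hl.1),
        c.right.lim_of_mem_C _ (c.left_U_subset_right_C hl.2)]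
      refine (dist_midpoint_midpoint_le _ _ _ _).trans ?_
      have : (0 : ℝ) ≤ (3 / 4) ^ n := by positivity
      rw [dist_self, add_zero]
      linarith
    · have hxl : x ∉ c.left.left.U := fun hx =>
        hl ⟨c.left.left_U_subset hx, h₄ (c.left.left_U_subset_right_C hx)⟩
      have hyl : y ∉ c.left.left.U := fun hy =>
        hl ⟨h₅ (c.left.left_U_subset_right_C hy), c.left.left_U_subset hy⟩
      simp only [pow_succ, c.lim_eq_midpoint, c.left.lim_eq_midpoint,
        c.left.left.lim_of_notMem_U _ hxl, c.left.left.lim_of_notMem_U _ hyl]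
      grw [dist_midpoint_midpoint_le, dist_midpoint_midpoint_le, dist_self, zero_add, h₂, h₃]
      exact le_of_eq (by ring)

/-- Disjoint and asymptotically disjoint closed sets are separated by a Higson function. -/
theorem IsProper.exists_higson_zero_one [NormalSpace X] (hproper : 𝓔.IsProper)
    (hconn : 𝓔.toAsymptoticResemblance.AsymptoticallyConnected)
    (hnormal : 𝓔.toAsymptoticResemblance.AsymptoticallyNormal)
    (hA : IsClosed A) (hB : IsClosed B) (hAB : Disjoint A B)
    (h : 𝓔.toAsymptoticResemblance.AsymptoticallyDisjoint A B) :
    ∃ f : 𝓔.higsonAlgebra, (∀ x ∈ A, f.1 x = 0) ∧ ∀ x ∈ B, f.1 x = 1 := by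
  let c : Urysohns.CU
      fun c u : Set X => 𝓔.toAsymptoticResemblance.AsymptoticallyDisjoint c uᶜ :=
    { C := A
      U := Bᶜ
      P_C_U := by rwa [compl_compl]
      closed_C := hA
      open_U := hB.isOpen_compl
      subset := hAB.subset_compl_right
      hP := fun hc hcu hu hsub => hproper.exists_isOpen_between hconn hnormal hc hcu hu hsub }
  let f : X →ᵇ ℂ := BoundedContinuousFunction.ofNormedAddCommGroup (fun x => (c.lim x : ℂ))
    (Complex.continuous_ofReal.comp c.continuous_lim) 1 fun x => by
      rw [Complex.norm_real, Real.norm_of_nonneg (c.lim_nonneg x)]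
      exact c.lim_le_one x
  have hf (x : X) : f x = (c.lim x : ℂ) := rfl
  refine ⟨⟨f, fun E hE ε hε => ?_⟩, fun x hx => ?_, fun x hx => ?_⟩
  · obtain ⟨n, hn⟩ := exists_pow_lt_of_lt_one hε (by norm_num : (3 / 4 : ℝ) < 1)
    obtain ⟨K, hK, h⟩ := hproper.exists_isCompact_dist_lim_le hconn hE n c
    refine ⟨K, hK, fun x y hxy => ?_⟩
    rw [hf, hf, ← Complex.ofReal_sub, Complex.norm_real, ← dist_eq_norm]
    exact (h x y hxy.1 hxy.2).trans_lt hn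
  · change f x = 0
    rw [hf, c.lim_of_mem_C x hx, Complex.ofReal_zero]
  · change f x = 1
    rw [hf, c.lim_of_notMem_U x (fun hn => hn hx), Complex.ofReal_one]

/-- A Higson function does not separate asymptotically alike unbounded sets. -/
theorem IsProper.exists_norm_sub_lt (hproper : 𝓔.IsProper)
    (hconn : 𝓔.toAsymptoticResemblance.AsymptoticallyConnected) {f : X →ᵇ ℂ} (hf : 𝓔.IsHigson f)
    {L₁ L₂ : Set X} (h : 𝓔.toAsymptoticResemblance.Sim L₁ L₂) {ε : ℝ} (hε : 0 < ε) :
    ∃ x ∈ L₁, ∃ y ∈ L₂, ‖f x - f y‖ < ε := by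
  obtain ⟨⟨x, hx⟩, -, rfl | ⟨h₁, -, E, hE, hs, -⟩⟩ := h
  · exact ⟨x, hx, x, hx, by simpa using hε⟩
  · obtain ⟨K, hK, hfK⟩ := hf _ (𝓔.inv_mem _ hE) ε hε
    rw [bounded_toAsymptoticResemblance_iff] at h₁
    obtain ⟨x, hx, hxK⟩ := not_subset.1
      fun hsub => h₁ ((hproper.bounded_of_isCompact hconn hK).mono hsub)
    obtain ⟨y, hy, hyx⟩ := hs hx
    exact ⟨x, hx, y, hy, hfK x y ⟨hyx, fun hm => hxK hm.1⟩⟩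

end CoarseStructure

/-! ### The Wallman compactification is compact -/

namespace Wallman

variable {X : Type*} [TopologicalSpace X]

/-- By maximality: if `A` meets every member, then `A` and `𝓕` generate a closed filter, which must
be `𝓕` itself. -/
theorem mem_iff (𝓕 : Wallman X) {A : Set X} (hA : IsClosed A) :
    A ∈ 𝓕.1 ↔ ∀ B ∈ 𝓕.1, (A ∩ B).Nonempty := by
  have hF := 𝓕.2.prop
  constructor
  · intro h B hB
    by_contra hn
    exact hF.empty_notMem (not_nonempty_iff_eq_empty.1 hn ▸ hF.inter_mem _ h _ hB)
  · intro h
    refine 𝓕.2.le_of_ge (y := {C | IsClosed C ∧ ∃ B ∈ 𝓕.1, A ∩ B ⊆ C}) ?_ ?_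
      ⟨hA, _, hF.univ_mem, inter_subset_left⟩
    · refine ⟨fun C hC => hC.1, ⟨isClosed_univ, _, hF.univ_mem, subset_univ _⟩, ?_, ?_, ?_⟩
      · rintro ⟨-, B, hB, hAB⟩
        exact (h B hB).ne_empty (subset_empty_iff.1 hAB)
      · rintro C ⟨hC, B, hB, hBC⟩ C' ⟨hC', B', hB', hBC'⟩
        exact ⟨hC.inter hC', _, hF.inter_mem _ hB _ hB', fun x hx =>
          ⟨hBC ⟨hx.1, hx.2.1⟩, hBC' ⟨hx.1, hx.2.2⟩⟩⟩
      · rintro C ⟨-, B, hB, hBC⟩ C' hC' hCC'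
        exact ⟨hC', B, hB, hBC.trans hCC'⟩
    · exact fun B hB => ⟨hF.isClosed B hB, B, hB, inter_subset_right⟩

theorem compl_mem_of_notMem_basicOpen {𝓕 : Wallman X} {U : Set X} (hU : IsOpen U)
    (h : 𝓕 ∉ basicOpen U) : Uᶜ ∈ 𝓕.1 := by
  rw [mem_iff _ hU.isClosed_compl]
  intro B hB
  obtain ⟨x, hxB, hxU⟩ := not_subset.1 fun hBU => h ⟨B, hB, hBU⟩
  exact ⟨x, hxU, hxB⟩

theorem isOpen_basicOpen {U : Set X} (hU : IsOpen U) : IsOpen (basicOpen U) :=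
  TopologicalSpace.isOpen_generateFrom_of_mem ⟨U, hU, rfl⟩

theorem _root_.IsClosedFilter.exists_wallman {𝓖 : Set (Set X)} (h𝓖 : IsClosedFilter 𝓖) :
    ∃ 𝓕 : Wallman X, 𝓖 ⊆ 𝓕.1 := by
  obtain ⟨𝓕, h, hm⟩ := zorn_subset_nonempty {𝓕 : Set (Set X) | IsClosedFilter 𝓕} (by
    intro c hc hchain hne
    refine ⟨⋃₀ c, ?_, fun s hs => subset_sUnion_of_mem hs⟩
    obtain ⟨s, hs⟩ := hne
    refine ⟨?_, ⟨s, hs, (hc hs).univ_mem⟩, ?_, ?_, ?_⟩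
    · rintro A ⟨t, ht, hA⟩
      exact (hc ht).isClosed A hA
    · rintro ⟨t, ht, h⟩
      exact (hc ht).empty_notMem h
    · rintro A ⟨t, ht, hA⟩ B ⟨u, hu, hB⟩
      rcases hchain.total ht hu with h | h
      · exact ⟨u, hu, (hc hu).inter_mem A (h hA) B hB⟩
      · exact ⟨t, ht, (hc ht).inter_mem A hA B (h hB)⟩
    · rintro A ⟨t, ht, hA⟩ B hB hAB
      exact ⟨t, ht, (hc ht).superset_mem A hA B hB hAB⟩) 𝓖 h𝓖
  exact ⟨⟨𝓕, hm⟩, h⟩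

/-- The closed sets belonging to `𝒰`-almost every point form a closed filter, and any closed
ultrafilter `𝓕₀` containing it is a limit of `𝒰`: if `U*` is not in `𝒰`, then `Uᶜ` belongs to almost
every point, hence to `𝓕₀`, which is then not in `U*`. -/
instance : CompactSpace (Wallman X) := by
  refine ⟨isCompact_iff_ultrafilter_le_nhds.2 fun 𝒰 _ => ?_⟩
  have hG : IsClosedFilter {A : Set X | IsClosed A ∧ {𝓕 : Wallman X | A ∈ 𝓕.1} ∈ 𝒰} := by
    refine ⟨fun A hA => hA.1, ⟨isClosed_univ, ?_⟩, fun h => ?_, ?_, ?_⟩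
    · exact Filter.mem_of_superset Filter.univ_mem fun 𝓕 _ => 𝓕.2.prop.univ_mem
    · obtain ⟨𝓕, h𝓕⟩ := Filter.nonempty_of_mem h.2
      exact 𝓕.2.prop.empty_notMem h𝓕
    · rintro A ⟨hA, hA'⟩ B ⟨hB, hB'⟩
      exact ⟨hA.inter hB, Filter.mem_of_superset (Filter.inter_mem hA' hB')
        fun 𝓕 h => 𝓕.2.prop.inter_mem A h.1 B h.2⟩
    · rintro A ⟨hA, hA'⟩ B hB hAB
      exact ⟨hB, Filter.mem_of_superset hA' fun 𝓕 h => 𝓕.2.prop.superset_mem A h B hB hAB⟩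
  obtain ⟨𝓕₀, h₀⟩ := hG.exists_wallman
  refine ⟨𝓕₀, mem_univ _, ?_⟩
  rw [TopologicalSpace.nhds_generateFrom]
  refine le_iInf₂ fun W hW => Filter.le_principal_iff.2 ?_
  obtain ⟨hW, U, hU, rfl⟩ := hW
  obtain ⟨B, hB, hBU⟩ := hW
  by_contra hn
  have hm : Uᶜ ∈ 𝓕₀.1 := h₀ ⟨hU.isClosed_compl,
    Filter.mem_of_superset (Ultrafilter.compl_mem_iff_notMem.2 hn)
      fun 𝓕 h => compl_mem_of_notMem_basicOpen hU h⟩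
  obtain ⟨x, hx, hxB⟩ := (mem_iff _ hU.isClosed_compl).1 hm B hB
  exact hx (hBU hxB)

/-! ### Limits of bounded functions along closed ultrafilters -/

/-- Boundedness of `f` gives a common cluster point of the images of the members; `mem_iff` upgrades
it to a limit. -/
theorem exists_limit (𝓕 : Wallman X) (f : X →ᵇ ℂ) :
    ∃ z : ℂ, ∀ ε > 0, {x | ‖f x - z‖ ≤ ε} ∈ 𝓕.1 := by
  have hF := 𝓕.2.prop
  have hne (A : Set X) (hA : A ∈ 𝓕.1) : A.Nonempty :=
    nonempty_iff_ne_empty.2 fun h => hF.empty_notMem (h ▸ hA)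
  obtain ⟨z, hz⟩ : (⋂ A : 𝓕.1, closure (f '' A)).Nonempty := by
    have : Nonempty 𝓕.1 := ⟨⟨_, hF.univ_mem⟩⟩
    refine IsCompact.nonempty_iInter_of_directed_nonempty_isCompact_isClosed _ ?_
      (fun A => ((hne A A.2).image f).closure) (fun A => ?_) fun A => isClosed_closure
    · intro A B
      exact ⟨⟨A ∩ B, hF.inter_mem _ A.2 _ B.2⟩,
        closure_mono (image_mono inter_subset_left), closure_mono (image_mono inter_subset_right)⟩
    · exact (f.isBounded_range.subset (image_subset_range f A)).isCompact_closure
  refine ⟨z, fun ε hε => (mem_iff _ (isClosed_le (by fun_prop) continuous_const)).2 fun B hB => ?_⟩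
  obtain ⟨_, ⟨x, hx, rfl⟩, hd⟩ := Metric.mem_closure_iff.1 (mem_iInter.1 hz ⟨B, hB⟩) ε hε
  refine ⟨x, ?_, hx⟩
  rw [dist_comm, dist_eq_norm] at hd
  exact hd.le

/-- The limit of a bounded continuous function along a closed ultrafilter. -/
noncomputable def limit (𝓕 : Wallman X) (f : X →ᵇ ℂ) : ℂ := (𝓕.exists_limit f).choose

theorem limit_spec (𝓕 : Wallman X) (f : X →ᵇ ℂ) {ε : ℝ} (hε : 0 < ε) :
    {x | ‖f x - 𝓕.limit f‖ ≤ ε} ∈ 𝓕.1 :=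
  (𝓕.exists_limit f).choose_spec ε hε

theorem limit_eq {𝓕 : Wallman X} {f : X →ᵇ ℂ} {z : ℂ}
    (h : ∀ ε > 0, ∃ A ∈ 𝓕.1, ∀ x ∈ A, ‖f x - z‖ ≤ ε) : 𝓕.limit f = z := by
  refine eq_of_forall_dist_le fun ε hε => ?_
  obtain ⟨A, hA, hAz⟩ := h (ε / 2) (half_pos hε)
  have hm := limit_spec 𝓕 f (half_pos hε)
  obtain ⟨x, hx, hxA⟩ := (mem_iff _ (𝓕.2.prop.isClosed _ hm)).1 hm A hA
  have h₁ : ‖f x - 𝓕.limit f‖ ≤ ε / 2 := hx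
  have h₂ := hAz x hxA
  rw [← dist_eq_norm] at h₁ h₂
  linarith [dist_triangle_left (𝓕.limit f) z (f x)]

theorem norm_limit_sub_le {𝓕 : Wallman X} {f : X →ᵇ ℂ} {z : ℂ} {A : Set X} (hA : A ∈ 𝓕.1) {ε : ℝ}
    (h : ∀ x ∈ A, ‖f x - z‖ ≤ ε) : ‖𝓕.limit f - z‖ ≤ ε := by
  refine le_of_forall_pos_le_add fun δ hδ => ?_
  have hm := limit_spec 𝓕 f hδ
  obtain ⟨x, hx, hxA⟩ := (mem_iff _ (𝓕.2.prop.isClosed _ hm)).1 hm A hA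
  have h₁ : ‖f x - 𝓕.limit f‖ ≤ δ := hx
  have h₂ := h x hxA
  rw [← dist_eq_norm] at *
  linarith [dist_triangle_left (𝓕.limit f) z (f x)]

theorem limit_add (𝓕 : Wallman X) (f g : X →ᵇ ℂ) :
    𝓕.limit (f + g) = 𝓕.limit f + 𝓕.limit g := by
  refine limit_eq fun ε hε => ⟨_, 𝓕.2.prop.inter_mem _ (limit_spec 𝓕 f (half_pos hε)) _
    (limit_spec 𝓕 g (half_pos hε)), ?_⟩
  rintro x ⟨hf : ‖f x - _‖ ≤ _, hg : ‖g x - _‖ ≤ _⟩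
  rw [BoundedContinuousFunction.add_apply, add_sub_add_comm]
  linarith [norm_add_le (f x - 𝓕.limit f) (g x - 𝓕.limit g)]

theorem norm_limit_le (𝓕 : Wallman X) (f : X →ᵇ ℂ) : ‖𝓕.limit f‖ ≤ ‖f‖ := by
  simpa using norm_limit_sub_le (z := 0) 𝓕.2.prop.univ_mem
    fun x _ => by simpa using f.norm_coe_le_norm x

theorem limit_mul (𝓕 : Wallman X) (f g : X →ᵇ ℂ) :
    𝓕.limit (f * g) = 𝓕.limit f * 𝓕.limit g := by
  refine limit_eq fun ε hε => ?_
  have hM : 0 < ‖f‖ + ‖g‖ + 1 := by positivity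
  have hδ : 0 < ε / (‖f‖ + ‖g‖ + 1) := by positivity
  refine ⟨_, 𝓕.2.prop.inter_mem _ (limit_spec 𝓕 f hδ) _ (limit_spec 𝓕 g hδ), ?_⟩
  rintro x ⟨hf : ‖f x - _‖ ≤ _, hg : ‖g x - _‖ ≤ _⟩
  have e : (f * g) x - 𝓕.limit f * 𝓕.limit g =
      f x * (g x - 𝓕.limit g) + (f x - 𝓕.limit f) * 𝓕.limit g := by
    simp only [BoundedContinuousFunction.mul_apply]
    ring
  rw [e]
  refine (norm_add_le _ _).trans ?_
  rw [norm_mul, norm_mul]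
  have b₁ := mul_le_mul (f.norm_coe_le_norm x) hg (norm_nonneg _) (norm_nonneg _)
  have b₂ := mul_le_mul hf (𝓕.norm_limit_le g) (norm_nonneg _) hδ.le
  have b₄ : ε / (‖f‖ + ‖g‖ + 1) * (‖f‖ + ‖g‖ + 1) = ε := by field_simp
  linarith

theorem limit_algebraMap (𝓕 : Wallman X) (c : ℂ) :
    𝓕.limit (algebraMap ℂ (X →ᵇ ℂ) c) = c :=
  limit_eq fun ε hε => ⟨_, 𝓕.2.prop.univ_mem, fun x _ => by
    simpa [BoundedContinuousFunction.algebraMap_apply] using hε.le⟩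

theorem limit_smul (𝓕 : Wallman X) (c : ℂ) (f : X →ᵇ ℂ) :
    𝓕.limit (c • f) = c * 𝓕.limit f := by
  rw [Algebra.smul_def, limit_mul, limit_algebraMap]

theorem limit_σ [T1Space X] (x : X) (f : X →ᵇ ℂ) : (σ x).limit f = f x :=
  limit_eq fun ε hε => ⟨{x}, ⟨isClosed_singleton, rfl⟩, by
    rintro _ rfl
    simpa using hε.le⟩

theorem continuous_limit (f : X →ᵇ ℂ) : Continuous fun 𝓕 : Wallman X => 𝓕.limit f := by
  refine Metric.continuous_iff'.2 fun 𝓕 ε hε => ?_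
  -- A closed sublevel set belongs to `𝓕`, while `U*` needs an open set: the gap between ε/4 and ε/2
  -- leaves room for both.
  have hU : IsOpen {x | ‖f x - 𝓕.limit f‖ < ε / 2} := isOpen_lt (by fun_prop) continuous_const
  have hsub : {x | ‖f x - 𝓕.limit f‖ ≤ ε / 4} ⊆ {x | ‖f x - 𝓕.limit f‖ < ε / 2} :=
    fun x hx => lt_of_le_of_lt (b := ε / 4) hx (by linarith)
  refine Filter.mem_of_superset ((isOpen_basicOpen hU).mem_nhds
    ⟨_, limit_spec 𝓕 f (by positivity), hsub⟩) ?_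
  rintro 𝓕' ⟨A, hA, hAU⟩
  rw [mem_ofPred_eq, dist_eq_norm]
  exact (norm_limit_sub_le hA fun x hx => le_of_lt (hAU hx)).trans_lt (half_lt_self hε)

end Wallman

/-! ### The map from the Wallman compactification to the Higson compactification -/

namespace CoarseStructure

variable {X : Type*} [TopologicalSpace X] (𝓔 : CoarseStructure X)

/-- The map `γX → hX` that sends a closed ultrafilter to the limit along it. -/
noncomputable def wallmanToHigson (𝓕 : Wallman X) : 𝓔.HigsonCompactification :=
  ⟨StrongDual.toWeakDual (LinearMap.mkContinuous
      { toFun := fun f : 𝓔.higsonAlgebra => 𝓕.limit f.1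
        map_add' := fun f g => 𝓕.limit_add f.1 g.1
        map_smul' := fun c f => 𝓕.limit_smul c f.1 } 1
      fun f => by simpa using 𝓕.norm_limit_le f.1), by
    refine ⟨fun h => ?_, fun f g => 𝓕.limit_mul f.1 g.1⟩
    have h1 := congrArg (fun φ : WeakDual ℂ 𝓔.higsonAlgebra => φ 1) h
    have h2 : 𝓕.limit 1 = 1 := by simpa using 𝓕.limit_algebraMap 1
    exact one_ne_zero (h2.symm.trans h1)⟩

theorem wallmanToHigson_apply (𝓕 : Wallman X) (f : 𝓔.higsonAlgebra) :
    𝓔.wallmanToHigson 𝓕 f = 𝓕.limit f.1 := rfl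

theorem wallmanToHigson_σ [T1Space X] (x : X) :
    𝓔.wallmanToHigson (Wallman.σ x) = 𝓔.toHigson x :=
  WeakDual.CharacterSpace.ext fun f => Wallman.limit_σ x f.1

theorem continuous_wallmanToHigson : Continuous 𝓔.wallmanToHigson :=
  Continuous.subtype_mk (WeakDual.continuous_of_continuous_eval
    fun f => Wallman.continuous_limit f.1) _

variable {𝓔}

/-- A Higson function that is bounded away from zero is invertible in `C_h(X)`. -/
theorem exists_mul_eq_one (f : 𝓔.higsonAlgebra) {ε : ℝ} (hε : 0 < ε) (h : ∀ x, ε ≤ ‖f.1 x‖) :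
    ∃ g : 𝓔.higsonAlgebra, f * g = 1 := by
  have hne (x : X) : f.1 x ≠ 0 := norm_pos_iff.1 (hε.trans_le (h x))
  let g : X →ᵇ ℂ := BoundedContinuousFunction.ofNormedAddCommGroup (fun x => (f.1 x)⁻¹)
    (f.1.continuous.inv₀ hne) ε⁻¹ fun x => by
      rw [norm_inv]
      exact inv_anti₀ hε (h x)
  have hg (x : X) : g x = (f.1 x)⁻¹ := rfl
  refine ⟨⟨g, fun E hE δ hδ => ?_⟩, ?_⟩
  · obtain ⟨K, hK, hfK⟩ := f.2 E hE (δ * (ε * ε)) (by positivity)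
    refine ⟨K, hK, fun x y hxy => ?_⟩
    rw [hg, hg, inv_sub_inv (hne x) (hne y), norm_div, norm_mul, norm_sub_rev]
    have hxy' := mul_le_mul (h x) (h y) hε.le (norm_nonneg _)
    rw [div_lt_iff₀ (lt_of_lt_of_le (by positivity) hxy')]
    exact (hfK x y hxy).trans_le (mul_le_mul_of_nonneg_left hxy' hδ.le)
  · apply Subtype.ext
    ext x
    exact mul_inv_cancel₀ (hne x)

theorem surjective_wallmanToHigson : Function.Surjective 𝓔.wallmanToHigson := by
  intro φ
  have hG : IsClosedFilter {A : Set X | IsClosed A ∧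
      ∃ f : 𝓔.higsonAlgebra, φ f = 0 ∧ ∃ ε > 0, {x | ‖f.1 x‖ ≤ ε} ⊆ A} := by
    refine ⟨fun A hA => hA.1, ⟨isClosed_univ, 0, map_zero φ, 1, one_pos, subset_univ _⟩, ?_, ?_, ?_⟩
    -- An empty sublevel set would make `f` invertible, although it lies in the kernel of `φ`.
    · rintro ⟨-, f, hf, ε, hε, h⟩
      obtain ⟨g, hg⟩ := exists_mul_eq_one f hε fun x => (not_le.1 fun hx => h hx).le
      have := congrArg φ hg
      rw [map_mul, hf, zero_mul, map_one] at this
      exact zero_ne_one this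
    · rintro A ⟨hA, f, hf, ε, hε, hfA⟩ B ⟨hB, g, hg, δ, hδ, hgB⟩
      -- The function `|f|² + |g|²` is again in the kernel, and where it is at most `(min ε δ)²`
      -- both `f` and `g` are small.
      refine ⟨hA.inter hB, star f * f + star g * g, by simp [hf, hg], (min ε δ) ^ 2,
        by positivity, fun x hx => ?_⟩
      have hval : (star f * f + star g * g).1 x = ((‖f.1 x‖ ^ 2 + ‖g.1 x‖ ^ 2 : ℝ) : ℂ) := by
        change star (f.1 x) * f.1 x + star (g.1 x) * g.1 x = _
        push_cast
        rw [← Complex.conj_mul', ← Complex.conj_mul']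
        rfl
      rw [mem_ofPred_eq, hval, Complex.norm_real, Real.norm_of_nonneg (by positivity)] at hx
      have hm : 0 ≤ min ε δ := le_min hε.le hδ.le
      constructor
      · exact hfA ((abs_le_of_sq_le_sq' (by nlinarith [sq_nonneg ‖g.1 x‖]) hm).2.trans
          (min_le_left _ _))
      · exact hgB ((abs_le_of_sq_le_sq' (by nlinarith [sq_nonneg ‖f.1 x‖]) hm).2.trans
          (min_le_right _ _))
    · rintro A ⟨-, f, hf, ε, hε, hfA⟩ B hB hAB
      exact ⟨hB, f, hf, ε, hε, hfA.trans hAB⟩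
  obtain ⟨𝓕, h𝓕⟩ := hG.exists_wallman
  refine ⟨𝓕, WeakDual.CharacterSpace.ext fun f => Wallman.limit_eq fun ε hε => ?_⟩
  -- Subtracting the value of `φ` puts `g` in the kernel, so the sublevel sets of `g` lie in `𝓕` and
  -- force the limit of `f` to be `φ f`.
  let g : 𝓔.higsonAlgebra := f - algebraMap ℂ 𝓔.higsonAlgebra (φ f)
  have hg (x : X) : g.1 x = f.1 x - φ f := by
    change f.1 x - (algebraMap ℂ (X →ᵇ ℂ) (φ f)) x = _
    simp [BoundedContinuousFunction.algebraMap_apply]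
  refine ⟨{x | ‖g.1 x‖ ≤ ε}, h𝓕 ⟨isClosed_le (by fun_prop) continuous_const, g, ?_, ε, hε,
    Subset.rfl⟩, fun x hx => ?_⟩
  · rw [map_sub, AlgHomClass.commutes]
    exact sub_self _
  · rw [← hg]
    exact hx

theorem IsProper.wallmanToHigson_eq_iff [NormalSpace X] (hproper : 𝓔.IsProper)
    (hconn : 𝓔.toAsymptoticResemblance.AsymptoticallyConnected)
    (hnormal : 𝓔.toAsymptoticResemblance.AsymptoticallyNormal) {𝓕₁ 𝓕₂ : Wallman X} :
    𝓔.wallmanToHigson 𝓕₁ = 𝓔.wallmanToHigson 𝓕₂ ↔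
      𝓔.toAsymptoticResemblance.Approx 𝓕₁ 𝓕₂ := by
  constructor
  · intro h A hA B hB
    by_contra hn
    have hAc := 𝓕₁.2.prop.isClosed A hA
    have hBc := 𝓕₂.2.prop.isClosed B hB
    -- The two alternatives in `Sim` fail separately: equality gives topological disjointness,
    -- alikeness gives asymptotic disjointness.
    have hAB : Disjoint A B := disjoint_iff_inter_eq_empty.2 <| not_nonempty_iff_eq_empty.1
      fun hne => hn ⟨_, _, inter_subset_left, inter_subset_right, hne, hne, Or.inl rfl⟩
    have hL : 𝓔.toAsymptoticResemblance.AsymptoticallyDisjoint A B := by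
      intro L₁ L₂ h₁ h₂ u₁ u₂ ha
      exact hn ⟨L₁, L₂, h₁, h₂, nonempty_iff_ne_empty.2 fun h => u₁ (Or.inl h),
        nonempty_iff_ne_empty.2 fun h => u₂ (Or.inl h), Or.inr ⟨u₁, u₂, ha⟩⟩
    obtain ⟨f, hf₀, hf₁⟩ := hproper.exists_higson_zero_one hconn hnormal hAc hBc hAB hL
    have e₀ : 𝓔.wallmanToHigson 𝓕₁ f = 0 :=
      Wallman.limit_eq fun ε hε => ⟨A, hA, fun x hx => by simpa [hf₀ x hx] using hε.le⟩
    have e₁ : 𝓔.wallmanToHigson 𝓕₂ f = 1 :=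
      Wallman.limit_eq fun ε hε => ⟨B, hB, fun x hx => by simpa [hf₁ x hx] using hε.le⟩
    rw [h, e₁] at e₀
    exact one_ne_zero e₀
  · refine fun h => WeakDual.CharacterSpace.ext fun f => eq_of_forall_dist_le fun ε hε => ?_
    have hε3 : 0 < ε / 3 := by positivity
    obtain ⟨L₁, L₂, h₁, h₂, hL⟩ :=
      h _ (𝓕₁.limit_spec f.1 hε3) _ (𝓕₂.limit_spec f.1 hε3)
    obtain ⟨x, hx, y, hy, hxy⟩ := hproper.exists_norm_sub_lt hconn f.2 hL hε3
    have hx' : ‖f.1 x - 𝓕₁.limit f.1‖ ≤ ε / 3 := h₁ hx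
    have hy' : ‖f.1 y - 𝓕₂.limit f.1‖ ≤ ε / 3 := h₂ hy
    rw [wallmanToHigson_apply, wallmanToHigson_apply]
    rw [← dist_eq_norm] at hx' hy' hxy
    rw [dist_comm] at hx'
    linarith [dist_triangle4 (𝓕₁.limit f.1) (f.1 x) (f.1 y) (𝓕₂.limit f.1)]

end CoarseStructure

/-! ### The homeomorphism. -/

theorem mainTheorem3 {X : Type*} [TopologicalSpace X] [T2Space X] [NormalSpace X]
    (𝓔 : CoarseStructure X) (hproper : 𝓔.IsProper)
    (hconn : 𝓔.toAsymptoticResemblance.AsymptoticallyConnected)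
    (hnormal : 𝓔.toAsymptoticResemblance.AsymptoticallyNormal) :
    Equivalence (𝓔.toAsymptoticResemblance.Approx) ∧
    ∃ Φ : 𝓔.HigsonCompactification ≃ₜ 𝓔.toAsymptoticResemblance.AsymptoticCompactification,
      (∀ x : X, Φ (𝓔.toHigson x) = 𝓔.toAsymptoticResemblance.toAsymptotic x) ∧
      Φ '' 𝓔.higsonCorona = 𝓔.toAsymptoticResemblance.asymptoticCorona := by
  have hker {𝓕₁ 𝓕₂ : Wallman X} :=
    hproper.wallmanToHigson_eq_iff hconn hnormal (𝓕₁ := 𝓕₁) (𝓕₂ := 𝓕₂)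
  refine ⟨⟨fun _ => hker.1 rfl, fun h => hker.1 (hker.2 h).symm,
    fun h h' => hker.1 ((hker.2 h).trans (hker.2 h'))⟩, ?_⟩
  let Ψ : 𝓔.toAsymptoticResemblance.AsymptoticCompactification → 𝓔.HigsonCompactification :=
    Quot.lift 𝓔.wallmanToHigson fun _ _ h => hker.2 h
  have hΨ : Continuous Ψ := continuous_quot_lift _ 𝓔.continuous_wallmanToHigson
  have hbij : Function.Bijective Ψ := by
    constructor
    · rintro ⟨𝓕₁⟩ ⟨𝓕₂⟩ h
      exact Quot.sound (hker.1 h)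
    · intro φ
      obtain ⟨𝓕, rfl⟩ := CoarseStructure.surjective_wallmanToHigson φ
      exact ⟨Quot.mk _ 𝓕, rfl⟩
  let Θ := Continuous.homeoOfEquivCompactToT2 (f := Equiv.ofBijective Ψ hbij) hΨ
  have hΘ (x : X) : Θ.symm (𝓔.toHigson x) = 𝓔.toAsymptoticResemblance.toAsymptotic x := by
    rw [Homeomorph.symm_apply_eq]
    exact (𝓔.wallmanToHigson_σ x).symm
  refine ⟨Θ.symm, hΘ, ?_⟩
  rw [CoarseStructure.higsonCorona, AsymptoticResemblance.asymptoticCorona,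
    image_compl_eq Θ.symm.bijective, ← range_comp]
  exact congrArg (fun f => (range f)ᶜ) (funext hΘ)
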